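/- **Syntax frameworks.** An interpreted language is a triple $I=(L,D,V)$ of a set $L$ of expressions, a nonempty set $D$ and a total function $V:L\to D$. A syntax framework for $(L,I)$ (with object language $L$) is a tuple $(D_{\rm syn},V_{\rm syn},L_{\rm syn},Q,E)$, where $\emptyset\ne D_{\rm syn}\subseteq D$; $V_{\rm syn}:L\to D_{\rm syn}$ is injective; $L_{\rm syn}\subseteq L$ with $V(L_{\rm syn})\subseteq D_{\rm syn}$; $Q:L\to L_{\rm syn}$ (quotation) is injective with $V(Q(e))=V_{\rm syn}(e)$ for all $e\in L$; and $E:L_{\rm syn}\rightharpoonup L$ (evaluation) is a possibly partial function such that, whenever $E(e)$ is defined, $V_{\rm syn}^{-1}(V(e))$ is defined and $V(E(e))=V(V_{\rm syn}^{-1}(V(e)))$. **The language.** Let $L$ be the set of terms and formulas of the first-order language with equality of arithmetic ($0$, successor, $+$, $\cdot$), extended by an operator $\mathsf{quote}$ which turns every expression $e\in L$ into a closed term $\mathsf{quote}(e)$, and by an operator $\mathsf{eval}$ which turns a term $t$ into a term $\mathsf{eval}_{\rm term}(t)$ or a formula $\mathsf{eval}_{\rm formula}(t)$, according to a type parameter;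 thus $\mathsf{eval}_{\rm term}$ is a unary function symbol and $\mathsf{eval}_{\rm formula}$ a unary predicate symbol. Let $M$ be a first-order interpretation of this language with domain $\mathbb N$ in which $0$ and successor have their usual meaning and the axioms of first-order Peano arithmetic (with induction for all formulas of $L$) are true; the denotations of the terms $\mathsf{quote}(e)$ and the meaning of the symbols $\mathsf{eval}_{\rm term}$, $\mathsf{eval}_{\rm formula}$ are otherwise arbitrary. Fix a variable assignment, let $V:L\to\mathbb N\cup\{\textsf{T},\textsf{F}\}$ be the resulting valuation and $I=(L,\mathbb N\cup\{\textsf{T},\textsf{F}\},V)$. Let $G:L\to\mathbb N$ be a Gödel numbering, i.e. $G(e)=g(e)$ for an injective computable function $g$ from the strings over the alphabet of $L$ to $\mathbb N$, where expressions are regarded as strings (in Polish notation). Let $L'_{\rm t}$ be the set of the terms $t$ such that $V(t)=G(e)$ for some $e\in L$. **Claim.** Let $F'=(\mathbb N,G,L'_{\rm t},Q,E')$ be any syntax framework for $(L,I)$ with built-in quotation and evaluation, that is, $Q(e)=\mathsf{quote}(e)$ for all $e\in L$, and $E'(t)\in\{\mathsf{eval}_{\rm term}(t),\mathsf{eval}_{\rm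 formula}(t)\}$ whenever $E'(t)$ is defined. Then $E'$ is not total on $L'_{\rm t}$. In particular, $E'$ is not total on quotations; in fact, there is a formula $A\in L$ such that $E'(\mathsf{quote}(A))$ is undefined. -/

import Mathlib

/-! ### Interpreted languages and syntax frameworks -/

universe u v

set_option linter.checkUnivs false in
/-- An interpreted language: a type `L` of expressions, a nonempty type `D` of semantic values
and a total semantic valuation function `V`. -/
structure InterpretedLanguage where
  L : Type u
  D : Type v
  nonempty : Nonempty D
  V : L → D

/-- A syntax framework `(Dsyn, Vsyn, Lsyn, Q, E)` for an object language `Lobj` in an interpreted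
language `I`. The evaluation function `E` may be partial. -/
structure SyntaxFramework (I : InterpretedLanguage.{u, v}) (Lobj : Set I.L) where
  /-- the syntactic values -/
  Dsyn : Set I.D
  Dsyn_nonempty : Dsyn.Nonempty
  /-- the syntactic valuation function -/
  Vsyn : Lobj → I.D
  Vsyn_mem : ∀ e, Vsyn e ∈ Dsyn
  Vsyn_injective : Function.Injective Vsyn
  /-- the syntax language -/
  Lsyn : Set I.L
  V_mem : ∀ e ∈ Lsyn, I.V e ∈ Dsyn
  /-- the quotation function -/
  Q : Lobj → Lsyn
  Q_injective : Function.Injective Q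
  quotation_axiom : ∀ e : Lobj, I.V (Q e) = Vsyn e
  /-- the evaluation function -/
  E : Lsyn →. Lobj
  /-- `V (E e) = V (Vsyn⁻¹ (V e))` whenever `E e` is defined; in particular, `Vsyn⁻¹ (V e)` is
  then defined. -/
  evaluation_axiom : ∀ (e : Lsyn) (r : Lobj), r ∈ E e →
    ∃ e' : Lobj, Vsyn e' = I.V e ∧ I.V r = I.V e'

namespace SyntaxFramework

variable {I : InterpretedLanguage.{u, v}} {Lobj : Set I.L}

/-- Quotations are the results of applying the (partial) operator `op` on expressions. -/
def HasBuiltInQuotation (F : SyntaxFramework I Lobj) (op : I.L → Option I.L) : Prop :=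
  ∀ e : Lobj, op e = some (F.Q e : I.L)

/-- Evaluations, whenever they are defined, are the results of applying the (partial) operator
`op` on expressions. The operator may carry a parameter that ranges over a set `ι` of types of
expressions. -/
def HasBuiltInEvaluation {ι : Type*} (F : SyntaxFramework I Lobj)
    (op : ι → I.L → Option I.L) : Prop :=
  ∀ (e : F.Lsyn) (r : Lobj), r ∈ F.E e → ∃ i : ι, op i e = some (r : I.L)

/-- The evaluation function is total. -/
def EvaluationTotal (F : SyntaxFramework I Lobj) : Prop :=
  ∀ e : F.Lsyn, (F.E e).Dom

/-- The evaluation function is defined on every quotation. -/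
def EvaluationTotalOnQuotations (F : SyntaxFramework I Lobj) : Prop :=
  ∀ e : Lobj, (F.E (F.Q e)).Dom

end SyntaxFramework

/-! ### First-order arithmetic with quotation and evaluation operators -/

namespace QuoteEvalArith

/-- The two types of expressions. -/
inductive Srt where
  | term
  | formula

/-- The expressions (terms and formulas) of the first-order language with equality of arithmetic
(`0`, successor, `+`, `·`), with variables `x₀, x₁, …`, extended by
* an operator `quote` that turns any expression into a (closed) term, and
* an operator `eval` that turns a term into an expression of the indicated type; so `eval term` is
  a unary function symbol and `eval formula` is a unary predicate symbol. -/
inductive Expr : Srt → Type where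
  | var (i : ℕ) : Expr .term
  | zero : Expr .term
  | succ (t : Expr .term) : Expr .term
  | add (t₁ t₂ : Expr .term) : Expr .term
  | mul (t₁ t₂ : Expr .term) : Expr .term
  | quote {s : Srt} (e : Expr s) : Expr .term
  | eval (s : Srt) (t : Expr .term) : Expr s
  | eq (t₁ t₂ : Expr .term) : Expr .formula
  | neg (A : Expr .formula) : Expr .formula
  | imp (A B : Expr .formula) : Expr .formula
  | all (i : ℕ) (A : Expr .formula) : Expr .formula

/-- The full language: all terms and all formulas. -/
abbrev Expression : Type := Σ s : Srt, Expr s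

/-- The operator `quote` on expressions. -/
def quoteOp (e : Expression) : Option Expression := some ⟨.term, .quote e.2⟩

/-- The operator `eval` on expressions, with its type parameter; it applies to terms only. -/
def evalOp (s : Srt) : Expression → Option Expression
  | ⟨.term, t⟩ => some ⟨s, .eval s t⟩
  | ⟨.formula, _⟩ => none

/-! ### Semantics -/

/-- Terms denote natural numbers, formulas denote truth values (classically, `Prop` has exactly the
two elements `True` and `False`). -/
abbrev Srt.Value : Srt → Type
  | .term => ℕ
  | .formula => Prop

/-- An interpretation of the language with domain `ℕ`, in which `0` and the successor symbol have
their usual meaning. The meaning of `+` and `·`, the denotations of the quotations, and the meaning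
of the function symbol `eval term` and of the predicate symbol `eval formula` are arbitrary. -/
structure Interpretation where
  add : ℕ → ℕ → ℕ
  mul : ℕ → ℕ → ℕ
  quote : Expression → ℕ
  eval : (s : Srt) → ℕ → s.Value

namespace Interpretation

/-- The usual first-order semantics: the value of an expression under a variable assignment. -/
def denote (M : Interpretation) : {s : Srt} → Expr s → (ℕ → ℕ) → s.Value
  | _, .var i, ρ => ρ i
  | _, .zero, _ => (0 : ℕ)
  | _, .succ t, ρ => Nat.succ (M.denote t ρ)
  | _, .add t₁ t₂, ρ => M.add (M.denote t₁ ρ) (M.denote t₂ ρ)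
  | _, .mul t₁ t₂, ρ => M.mul (M.denote t₁ ρ) (M.denote t₂ ρ)
  | _, .quote (s := s) e, _ => M.quote ⟨s, e⟩
  | _, .eval s t, ρ => M.eval s (M.denote t ρ)
  | _, .eq t₁ t₂, ρ => (M.denote t₁ ρ : ℕ) = M.denote t₂ ρ
  | _, .neg A, ρ => ¬ M.denote A ρ
  | _, .imp A B, ρ => M.denote A ρ → M.denote B ρ
  | _, .all i A, ρ => ∀ n : ℕ, M.denote A (Function.update ρ i n)

/-- The semantic valuation function with values in `ℕ ∪ {T, F}`. -/
def V (M : Interpretation) (ρ : ℕ → ℕ) : Expression → ℕ ⊕ Prop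
  | ⟨.term, t⟩ => Sum.inl (M.denote t ρ)
  | ⟨.formula, A⟩ => Sum.inr (M.denote A ρ)

/-- The interpreted language `(L, ℕ ∪ {T, F}, V)` given by an interpretation and a variable
assignment. -/
def interpretedLanguage (M : Interpretation) (ρ : ℕ → ℕ) :
    InterpretedLanguage.{0, 0} where
  L := Expression
  D := ℕ ⊕ Prop
  nonempty := ⟨Sum.inl 0⟩
  V := M.V ρ

end Interpretation

/-! ### Peano arithmetic -/

/-- `e.subst x u` replaces the free occurrences of the variable `x` in `e` by the term `u`.
Nothing occurs free in a quotation. (It is used only for `u = 0` and `u = S x`, where no variable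
can be captured.) -/
def Expr.subst : {s : Srt} → Expr s → (x : ℕ) → (u : Expr .term) → Expr s
  | _, .var i, x, u => if i = x then u else .var i
  | _, .zero, _, _ => .zero
  | _, .succ t, x, u => .succ (t.subst x u)
  | _, .add t₁ t₂, x, u => .add (t₁.subst x u) (t₂.subst x u)
  | _, .mul t₁ t₂, x, u => .mul (t₁.subst x u) (t₂.subst x u)
  | _, .quote e, _, _ => .quote e
  | _, .eval s t, x, u => .eval s (t.subst x u)
  | _, .eq t₁ t₂, x, u => .eq (t₁.subst x u) (t₂.subst x u)
  | _, .neg A, x, u => .neg (A.subst x u)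
  | _, .imp A B, x, u => .imp (A.subst x u) (B.subst x u)
  | _, .all i A, x, u => if i = x then .all i A else .all i (A.subst x u)

/-- The axioms of first-order Peano arithmetic, with the induction scheme for all formulas of the
language. -/
inductive PeanoAxiom : Expr .formula → Prop
  | eq_trans : PeanoAxiom (.imp (.eq (.var 0) (.var 1))
      (.imp (.eq (.var 0) (.var 2)) (.eq (.var 1) (.var 2))))
  | eq_succ : PeanoAxiom (.imp (.eq (.var 0) (.var 1)) (.eq (.succ (.var 0)) (.succ (.var 1))))
  | zero_ne_succ : PeanoAxiom (.neg (.eq .zero (.succ (.var 0))))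
  | succ_inj : PeanoAxiom (.imp (.eq (.succ (.var 0)) (.succ (.var 1))) (.eq (.var 0) (.var 1)))
  | add_zero : PeanoAxiom (.eq (.add (.var 0) .zero) (.var 0))
  | add_succ : PeanoAxiom
      (.eq (.add (.var 0) (.succ (.var 1))) (.succ (.add (.var 0) (.var 1))))
  | mul_zero : PeanoAxiom (.eq (.mul (.var 0) .zero) .zero)
  | mul_succ : PeanoAxiom
      (.eq (.mul (.var 0) (.succ (.var 1))) (.add (.mul (.var 0) (.var 1)) (.var 0)))
  | induction (x : ℕ) (A : Expr .formula) : PeanoAxiom (.imp (A.subst x .zero)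
      (.imp (.all x (.imp A (A.subst x (.succ (.var x))))) (.all x A)))

/-- The axioms of Peano arithmetic are true in the interpretation. -/
def Interpretation.SatisfiesPA (M : Interpretation) : Prop :=
  ∀ A, PeanoAxiom A → ∀ ρ : ℕ → ℕ, M.denote A ρ

/-! ### Gödel numberings -/

/-- The alphabet of the language. -/
inductive Sym where
  | zero | succ | add | mul | quote | tEval | fEval | eq | neg | imp | all
  | var (i : ℕ)

/-- The symbols are listed effectively. -/
def Sym.equivNat : Sym ≃ ℕ where
  toFun
    | .zero => 0 | .succ => 1 | .add => 2 | .mul => 3 | .quote => 4 | .tEval => 5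
    | .fEval => 6 | .eq => 7 | .neg => 8 | .imp => 9 | .all => 10 | .var i => i + 11
  invFun
    | 0 => .zero | 1 => .succ | 2 => .add | 3 => .mul | 4 => .quote | 5 => .tEval
    | 6 => .fEval | 7 => .eq | 8 => .neg | 9 => .imp | 10 => .all | i + 11 => .var i
  left_inv a := by cases a <;> rfl
  right_inv n := by
    match n with
    | 0 | 1 | 2 | 3 | 4 | 5 | 6 | 7 | 8 | 9 | 10 => rfl
    | i + 11 => rfl

instance : Primcodable Sym := Primcodable.ofEquiv ℕ Sym.equivNat

/-- The symbol of the operator `eval` at a type. -/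
def Srt.evalSym : Srt → Sym
  | .term => .tEval
  | .formula => .fEval

/-- An expression as a string of symbols (in Polish notation, so that no parentheses are
needed). -/
def Expr.str : {s : Srt} → Expr s → List Sym
  | _, .var i => [.var i]
  | _, .zero => [.zero]
  | _, .succ t => .succ :: t.str
  | _, .add t₁ t₂ => .add :: (t₁.str ++ t₂.str)
  | _, .mul t₁ t₂ => .mul :: (t₁.str ++ t₂.str)
  | _, .quote e => .quote :: e.str
  | _, .eval s t => s.evalSym :: t.str
  | _, .eq t₁ t₂ => .eq :: (t₁.str ++ t₂.str)
  | _, .neg A => .neg :: A.str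
  | _, .imp A B => .imp :: (A.str ++ B.str)
  | _, .all i A => .all :: .var i :: A.str

/-- A Gödel numbering of the expressions: it assigns numbers to strings of symbols injectively and
effectively, and to an expression the number of the string that it is. -/
def IsGoedelNumbering (G : Expression → ℕ) : Prop :=
  ∃ g : List Sym → ℕ, Function.Injective g ∧ Computable g ∧ ∀ e : Expression, G e = g e.2.str

/-- The terms whose value is the Gödel number of some expression. -/
def goedelTerms (M : Interpretation) (ρ : ℕ → ℕ) (G : Expression → ℕ) : Set Expression :=
  {e | ∃ t : Expr .term, e = ⟨.term, t⟩ ∧ ∃ e' : Expression, M.denote t ρ = G e'}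

/-- The syntax framework `F` for `(L, I)` is of the form `(ℕ, G, L'ₜ, Q, E)`, where `L'ₜ` is the
set of the terms whose value is a Gödel number, and it has built-in quotation and built-in
evaluation. -/
structure IsGoedelFramework (M : Interpretation) (ρ : ℕ → ℕ) (G : Expression → ℕ)
    (F : SyntaxFramework (M.interpretedLanguage ρ) Set.univ) : Prop where
  Dsyn_eq : F.Dsyn = Set.range (Sum.inl : ℕ → ℕ ⊕ Prop)
  Vsyn_eq : ∀ e : (Set.univ : Set Expression), F.Vsyn e = (Sum.inl (G e) : ℕ ⊕ Prop)
  Lsyn_eq : F.Lsyn = goedelTerms M ρ G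
  builtInQuotation : F.HasBuiltInQuotation quoteOp
  builtInEvaluation : F.HasBuiltInEvaluation evalOp

end QuoteEvalArith

/-! This is Tarski's theorem on the undefinability of truth. By the quotation axiom, `quote A`
denotes the Gödel number of `A`. If `E` is defined at `quote A`, its value must be `eval formula
(quote A)`, because a term has a number and not a truth value; the evaluation axiom and the
injectivity of `Vsyn` then say that this formula has the same truth value as `A`. If that held for
every formula `A`, then `eval formula` would be a truth predicate for a language containing it.

To refute this, a liar is built. Since the domain is `ℕ` with the true zero and successor, the Peano
axioms force addition and multiplication to be standard, so the graph of every partial recursive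
function is definable (`SatisfiesPA.definable_graph`, through Gödel's beta function).
Diagonalisation needs no arithmetised substitution: thanks to `quote`, the formula `∀ x₀, x₀ = quote
A → A` applies `A` to its own number, and its string is a fixed prefix followed by that of `A`
twice. Let `A` say that the diagonal of the string numbered `x₀` does not satisfy `eval formula`;
then `A.diag` is the liar. -/

namespace QuoteEvalArith.Interpretation

variable {M : Interpretation}

/-! ### Arithmetically definable relations and functions -/

/-- The relation `R` is defined by a formula, whatever variables are chosen for its arguments. -/
def Definable (M : Interpretation) {n : ℕ} (R : (Fin n → ℕ) → Prop) : Prop :=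
  ∀ v : Fin n → ℕ, ∃ A : Expr .formula, ∀ ρ : ℕ → ℕ, M.denote A ρ ↔ R (ρ ∘ v)

/-- The function `f` has a definable graph; the first argument of the graph is the value. -/
def DefinableFun (M : Interpretation) {n : ℕ} (f : (Fin n → ℕ) → ℕ) : Prop :=
  M.Definable fun w : Fin (n + 1) → ℕ => f (Fin.tail w) = w 0

namespace Definable

variable {n k : ℕ} {R S : (Fin n → ℕ) → Prop}

theorem of_iff (hR : M.Definable R) (h : ∀ w, S w ↔ R w) : M.Definable S := by
  rwa [show S = R from funext fun w => propext (h w)]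

theorem reindex (hR : M.Definable R) (σ : Fin n → Fin k) :
    M.Definable fun w : Fin k → ℕ => R (w ∘ σ) := fun v => hR (v ∘ σ)

theorem not (hR : M.Definable R) : M.Definable fun w => ¬ R w := fun v => by
  obtain ⟨A, hA⟩ := hR v
  exact ⟨.neg A, fun ρ => not_congr (hA ρ)⟩

theorem imp (hR : M.Definable R) (hS : M.Definable S) :
    M.Definable fun w => R w → S w := fun v => by
  obtain ⟨A, hA⟩ := hR v
  obtain ⟨B, hB⟩ := hS v
  exact ⟨.imp A B, fun ρ => imp_congr (hA ρ) (hB ρ)⟩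

theorem and (hR : M.Definable R) (hS : M.Definable S) : M.Definable fun w => R w ∧ S w :=
  (hR.imp hS.not).not.of_iff fun w => by tauto

theorem or (hR : M.Definable R) (hS : M.Definable S) : M.Definable fun w => R w ∨ S w :=
  (hR.not.imp hS).of_iff fun w => by tauto

theorem all {R : ℕ → (Fin n → ℕ) → Prop}
    (hR : M.Definable fun w : Fin (n + 1) → ℕ => R (w 0) (Fin.tail w)) :
    M.Definable fun w => ∀ x, R x w := fun v => by
  -- The bound variable must be fresh, so that updating it leaves the other arguments alone.
  obtain ⟨m, hm⟩ : ∃ m, ∀ i, v i ≠ m :=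
    ⟨Finset.univ.sup v + 1, fun i => (Nat.lt_succ_of_le (Finset.le_sup (Finset.mem_univ i))).ne⟩
  obtain ⟨A, hA⟩ := hR (Fin.cons m v)
  refine ⟨.all m A, fun ρ => forall_congr' fun x => (hA _).trans ?_⟩
  have h : Fin.tail (Function.update ρ m x ∘ (Fin.cons m v : Fin (n + 1) → ℕ)) = ρ ∘ v := by
    funext i
    simp [Fin.tail, hm i]
  beta_reduce
  rw [h]
  simp

theorem ex {R : ℕ → (Fin n → ℕ) → Prop}
    (hR : M.Definable fun w : Fin (n + 1) → ℕ => R (w 0) (Fin.tail w)) :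
    M.Definable fun w => ∃ x, R x w :=
  (all (R := fun x w => ¬ R x w) hR.not).not.of_iff fun w => by simp

/-- A definable function may be substituted for an argument of a definable relation. -/
theorem subst {R : ℕ → (Fin n → ℕ) → Prop} {f : (Fin n → ℕ) → ℕ}
    (hR : M.Definable fun w : Fin (n + 1) → ℕ => R (w 0) (Fin.tail w)) (hf : M.DefinableFun f) :
    M.Definable fun w => R (f w) w :=
  (ex (R := fun x w => f w = x ∧ R x w) (and hf hR)).of_iff fun w => by simp

end Definable

theorem DefinableFun.weaken {n : ℕ} {f : (Fin n → ℕ) → ℕ} (hf : M.DefinableFun f) :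
    M.DefinableFun fun w : Fin (n + 1) → ℕ => f (Fin.tail w) :=
  -- Slot 0 still holds the value of the function; slot 1 is the dummy argument, which is skipped.
  Definable.reindex hf (Fin.cons 0 fun i => i.succ.succ)

namespace Definable

variable {n : ℕ}

/-- Arguments are substituted one at a time; each newly introduced variable sits in slot 0, which
explains the permutations. -/
theorem comp₂ {r : ℕ → ℕ → Prop} {f g : (Fin n → ℕ) → ℕ}
    (hr : M.Definable fun w : Fin 2 → ℕ => r (w 0) (w 1))
    (hf : M.DefinableFun f) (hg : M.DefinableFun g) :
    M.Definable fun w => r (f w) (g w) :=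
  subst (R := fun x w => r x (g w))
    (subst (R := fun y w => r (w 0) y) (hr.reindex ![1, 0]) hg.weaken) hf

theorem comp₃ {r : ℕ → ℕ → ℕ → Prop} {f g h : (Fin n → ℕ) → ℕ}
    (hr : M.Definable fun w : Fin 3 → ℕ => r (w 0) (w 1) (w 2))
    (hf : M.DefinableFun f) (hg : M.DefinableFun g) (hh : M.DefinableFun h) :
    M.Definable fun w => r (f w) (g w) (h w) :=
  subst (R := fun x w => r x (g w) (h w))
    (subst (R := fun y w => r (w 0) y (h (Fin.tail w)))
      (subst (R := fun z w => r (w 1) (w 0) z) (hr.reindex ![2, 1, 0]) hh.weaken.weaken)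
      hg.weaken) hf

theorem eq {f g : (Fin n → ℕ) → ℕ} (hf : M.DefinableFun f) (hg : M.DefinableFun g) :
    M.Definable fun w => f w = g w :=
  comp₂ (r := fun x y => x = y)
    (fun v => ⟨.eq (.var (v 0)) (.var (v 1)), fun _ => Iff.rfl⟩) hf hg

theorem eval_formula : M.Definable fun w : Fin 1 → ℕ => M.eval .formula (w 0) :=
  fun v => ⟨.eval .formula (.var (v 0)), fun _ => Iff.rfl⟩

end Definable

namespace DefinableFun

variable {n : ℕ} {f g : (Fin n → ℕ) → ℕ}

theorem proj (i : Fin n) : M.DefinableFun fun w => w i := fun v =>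
  ⟨.eq (.var (v i.succ)) (.var (v 0)), fun _ => Iff.rfl⟩

theorem zero : M.DefinableFun fun _ : Fin n → ℕ => 0 := fun v =>
  ⟨.eq .zero (.var (v 0)), fun _ => Iff.rfl⟩

theorem comp₁ {φ : ℕ → ℕ} (hφ : M.DefinableFun fun w : Fin 1 → ℕ => φ (w 0))
    (hf : M.DefinableFun f) : M.DefinableFun fun w => φ (f w) :=
  Definable.comp₂ (r := fun x z => φ x = z) (Definable.reindex hφ ![1, 0]) hf.weaken (proj 0)

theorem comp₂ {φ : ℕ → ℕ → ℕ} (hφ : M.DefinableFun fun w : Fin 2 → ℕ => φ (w 0) (w 1))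
    (hf : M.DefinableFun f) (hg : M.DefinableFun g) : M.DefinableFun fun w => φ (f w) (g w) :=
  Definable.comp₃ (r := fun x y z => φ x y = z) (Definable.reindex hφ ![2, 0, 1])
    hf.weaken hg.weaken (proj 0)

theorem succ (hf : M.DefinableFun f) : M.DefinableFun fun w => f w + 1 :=
  comp₁ (φ := fun x => x + 1)
    (fun v => ⟨.eq (.succ (.var (v 1))) (.var (v 0)), fun _ => Iff.rfl⟩) hf

end DefinableFun

/-! ### Standard arithmetic: pairing, remainders and the beta function -/

namespace SatisfiesPA

variable {n : ℕ} {f g : (Fin n → ℕ) → ℕ}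

/-- As every element of the domain is a true numeral, the recursion equations alone determine the
operation, by induction outside the language. -/
theorem add_eq (hM : M.SatisfiesPA) (a b : ℕ) : M.add a b = a + b := by
  induction b with
  | zero => exact hM _ .add_zero fun _ => a
  | succ b ih =>
    have : M.add a (b + 1) = M.add a b + 1 := hM _ .add_succ fun i => if i = 0 then a else b
    omega

theorem mul_eq (hM : M.SatisfiesPA) (a b : ℕ) : M.mul a b = a * b := by
  induction b with
  | zero => exact hM _ .mul_zero fun _ => a
  | succ b ih =>
    have : M.mul a (b + 1) = M.add (M.mul a b) a :=
      hM _ .mul_succ fun i => if i = 0 then a else b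
    rw [this, ih, hM.add_eq, Nat.mul_succ]

theorem definableFun_add (hM : M.SatisfiesPA) (hf : M.DefinableFun f) (hg : M.DefinableFun g) :
    M.DefinableFun fun w => f w + g w :=
  DefinableFun.comp₂ (φ := fun x y => x + y) (fun v =>
    ⟨.eq (.add (.var (v 1)) (.var (v 2))) (.var (v 0)), fun ρ => by
      simp [denote, hM.add_eq, Fin.tail]⟩) hf hg

theorem definableFun_mul (hM : M.SatisfiesPA) (hf : M.DefinableFun f) (hg : M.DefinableFun g) :
    M.DefinableFun fun w => f w * g w :=
  DefinableFun.comp₂ (φ := fun x y => x * y) (fun v =>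
    ⟨.eq (.mul (.var (v 1)) (.var (v 2))) (.var (v 0)), fun ρ => by
      simp [denote, hM.mul_eq, Fin.tail]⟩) hf hg

theorem definable_lt (hM : M.SatisfiesPA) (hf : M.DefinableFun f) (hg : M.DefinableFun g) :
    M.Definable fun w => f w < g w :=
  (Definable.ex (R := fun d w => f w + d + 1 = g w)
    (.eq (hM.definableFun_add hf.weaken (.proj 0)).succ hg.weaken)).of_iff fun w =>
      ⟨fun h => ⟨g w - f w - 1, by omega⟩, fun ⟨d, hd⟩ => by omega⟩

theorem definableFun_pair (hM : M.SatisfiesPA) (hf : M.DefinableFun f) (hg : M.DefinableFun g) :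
    M.DefinableFun fun w => Nat.pair (f w) (g w) := by
  refine DefinableFun.comp₂ (φ := Nat.pair) ?_ hf hg
  have hx : M.DefinableFun fun w : Fin 3 → ℕ => w 1 := .proj 1
  have hy : M.DefinableFun fun w : Fin 3 → ℕ => w 2 := .proj 2
  have hz : M.DefinableFun fun w : Fin 3 → ℕ => w 0 := .proj 0
  have hlt := hM.definable_lt hx hy
  refine ((hlt.and (.eq (hM.definableFun_add (hM.definableFun_mul hy hy) hx) hz)).or
    (hlt.not.and (.eq (hM.definableFun_add
      (hM.definableFun_add (hM.definableFun_mul hx hx) hx) hy) hz))).of_iff fun w => ?_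
  simp only [Fin.tail, Nat.pair, Fin.succ_zero_eq_one, Fin.succ_one_eq_two]
  split_ifs with h <;> simp [h]

theorem definableFun_unpair_fst (hM : M.SatisfiesPA) (hf : M.DefinableFun f) :
    M.DefinableFun fun w => (f w).unpair.1 := by
  refine DefinableFun.comp₁ (φ := fun x => x.unpair.1) ?_ hf
  refine (Definable.ex (R := fun y w => Nat.pair (w 0) y = w 1)
    (.eq (hM.definableFun_pair (.proj 1) (.proj 0)) (.proj 2))).of_iff fun w => ?_
  exact ⟨fun h => ⟨(w 1).unpair.2, h ▸ Nat.pair_unpair (w 1)⟩, fun ⟨y, hy⟩ => by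
    simp [Fin.tail, ← hy]⟩

theorem definableFun_unpair_snd (hM : M.SatisfiesPA) (hf : M.DefinableFun f) :
    M.DefinableFun fun w => (f w).unpair.2 := by
  refine DefinableFun.comp₁ (φ := fun x => x.unpair.2) ?_ hf
  refine (Definable.ex (R := fun y w => Nat.pair y (w 0) = w 1)
    (.eq (hM.definableFun_pair (.proj 0) (.proj 1)) (.proj 2))).of_iff fun w => ?_
  exact ⟨fun h => ⟨(w 1).unpair.1, h ▸ Nat.pair_unpair (w 1)⟩, fun ⟨y, hy⟩ => by
    simp [Fin.tail, ← hy]⟩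

/-- A modulus `y + 1` is never zero, so the remainder is characterised by division; `Nat.beta` uses
only such moduli. -/
theorem definableFun_mod_succ (hM : M.SatisfiesPA) (hf : M.DefinableFun f)
    (hg : M.DefinableFun g) : M.DefinableFun fun w => f w % (g w + 1) := by
  refine DefinableFun.comp₂ (φ := fun x y => x % (y + 1)) ?_ hf hg
  have hr : M.DefinableFun fun w : Fin 4 → ℕ => w 1 := .proj 1
  have hy : M.DefinableFun fun w : Fin 4 → ℕ => w 3 + 1 := (DefinableFun.proj 3).succ
  refine (Definable.ex (R := fun q w => w 0 < w 2 + 1 ∧ w 0 + (w 2 + 1) * q = w 1)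
    ((hM.definable_lt hr hy).and
      (.eq (hM.definableFun_add hr (hM.definableFun_mul hy (.proj 0))) (.proj 2)))).of_iff
    fun w => ⟨fun h => ⟨w 1 / (w 2 + 1), h ▸ Nat.mod_lt _ (Nat.succ_pos _),
      h ▸ Nat.mod_add_div (w 1) (w 2 + 1)⟩, fun ⟨q, hq, he⟩ => ?_⟩
  simp only [Fin.tail, Fin.succ_zero_eq_one, Fin.succ_one_eq_two]
  rw [← he, Nat.add_mul_mod_self_left, Nat.mod_eq_of_lt hq]

theorem definableFun_beta (hM : M.SatisfiesPA) (hf : M.DefinableFun f) (hg : M.DefinableFun g) :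
    M.DefinableFun fun w => Nat.beta (f w) (g w) :=
  hM.definableFun_mod_succ (hM.definableFun_unpair_fst hf)
    (hM.definableFun_mul hg.succ (hM.definableFun_unpair_snd hf))

end SatisfiesPA
end QuoteEvalArith.Interpretation

/-! ### Coding recursions by single numbers -/

/-- A course of values of a primitive recursion is coded by a number via Gödel's beta function. -/
theorem Nat.mem_rec_iff_exists_beta {f : Part ℕ} {g : ℕ → ℕ →. ℕ} {n b : ℕ} :
    b ∈ (Nat.rec f (fun y IH => IH.bind fun i => g y i) n : Part ℕ) ↔
      ∃ c, Nat.beta c 0 ∈ f ∧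
        (∀ i, i < n → Nat.beta c (i + 1) ∈ g i (Nat.beta c i)) ∧ Nat.beta c n = b := by
  set F : ℕ → Part ℕ := fun n => Nat.rec f (fun y IH => IH.bind fun i => g y i) n
  have hF : ∀ m, F (m + 1) = (F m).bind fun i => g m i := fun _ => rfl
  change b ∈ F n ↔ _
  constructor
  · intro hb
    -- A recursion that converges at `n` converges at all earlier stages, so there is a full list of
    -- values to code.
    have hdom : ∀ i, i ≤ n → ∃ x, x ∈ F i := fun i hi =>
      Nat.decreasingInduction' (P := fun i => ∃ x, x ∈ F i)
        (fun k _ _ ⟨x, hx⟩ => by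
          rw [hF, Part.mem_bind_iff] at hx
          exact ⟨_, hx.choose_spec.1⟩) hi ⟨b, hb⟩
    choose! u hu using hdom
    refine ⟨Nat.unbeta (List.ofFn fun i : Fin (n + 1) => u i), ?_⟩
    have hbeta : ∀ i, i ≤ n →
        Nat.beta (Nat.unbeta (List.ofFn fun i : Fin (n + 1) => u i)) i = u i := fun i hi => by
      simpa [-List.ofFn_succ] using Nat.beta_unbeta_coe (List.ofFn fun i : Fin (n + 1) => u i)
        ⟨i, by simpa using Nat.lt_succ_of_le hi⟩
    refine ⟨hbeta 0 n.zero_le ▸ hu 0 n.zero_le, fun i hi => ?_,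
      (hbeta n le_rfl).trans (Part.mem_unique (hu n le_rfl) hb)⟩
    rw [hbeta i hi.le, hbeta (i + 1) hi]
    obtain ⟨x, hx, hxg⟩ := Part.mem_bind_iff.1 (hF i ▸ hu (i + 1) hi)
    rwa [Part.mem_unique (hu i hi.le) hx]
  · rintro ⟨c, h0, hs, rfl⟩
    have : ∀ i, i ≤ n → Nat.beta c i ∈ F i := fun i => by
      induction i with
      | zero => exact fun _ => h0
      | succ i ih => exact fun hi => hF i ▸ Part.mem_bind (ih (Nat.le_of_succ_le hi)) (hs i hi)
    exact this n le_rfl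

/-! ### Definability of partial recursive functions -/

namespace QuoteEvalArith

namespace Interpretation

variable {M : Interpretation}

/-- The graph of a partial recursive function is definable in arithmetic. -/
theorem SatisfiesPA.definable_graph (hM : M.SatisfiesPA) {f : ℕ →. ℕ} (hf : Nat.Partrec f) :
    M.Definable fun w : Fin 2 → ℕ => w 1 ∈ f (w 0) := by
  induction hf with
  | zero =>
    exact (Definable.eq (.proj 1) .zero).of_iff fun w => Part.mem_some_iff
  | succ =>
    exact (Definable.eq (.proj 1) (DefinableFun.proj 0).succ).of_iff fun w => Part.mem_some_iff
  | left =>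
    exact (Definable.eq (.proj 1) (hM.definableFun_unpair_fst (.proj 0))).of_iff
      fun w => Part.mem_some_iff
  | right =>
    exact (Definable.eq (.proj 1) (hM.definableFun_unpair_snd (.proj 0))).of_iff
      fun w => Part.mem_some_iff
  | @pair f g _ _ hf hg =>
    refine (((hf.comp₂ (r := fun x y => y ∈ f x) (.proj 0)
      (hM.definableFun_unpair_fst (.proj 1)))).and
      (hg.comp₂ (r := fun x y => y ∈ g x) (.proj 0)
      (hM.definableFun_unpair_snd (.proj 1)))).of_iff fun w => ?_
    simp only [Seq.seq, Part.map_eq_map, Part.mem_bind_iff, Part.mem_map_iff]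
    constructor
    · rintro ⟨_, ⟨x, hx, rfl⟩, y, hy, h⟩
      simpa [← h] using ⟨hx, hy⟩
    · exact fun ⟨hx, hy⟩ => ⟨_, ⟨_, hx, rfl⟩, _, hy, Nat.pair_unpair _⟩
  | @comp f g _ _ hf hg =>
    exact (Definable.ex (R := fun x w => x ∈ g (w 0) ∧ w 1 ∈ f x)
      ((hg.reindex ![1, 0]).and (hf.reindex ![0, 2]))).of_iff fun w => Part.mem_bind_iff
  | @prec f g _ _ hf hg =>
    -- The slots are the code of the course of values, the input and the output.
    have h0 : M.Definable fun w : Fin 3 → ℕ => Nat.beta (w 0) 0 ∈ f (w 1).unpair.1 :=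
      hf.comp₂ (r := fun x y => y ∈ f x) (hM.definableFun_unpair_fst (.proj 1))
        (hM.definableFun_beta (.proj 0) .zero)
    have hs : M.Definable fun w : Fin 3 → ℕ => ∀ i, i < (w 1).unpair.2 →
        Nat.beta (w 0) (i + 1) ∈
          g (Nat.pair (w 1).unpair.1 (Nat.pair i (Nat.beta (w 0) i))) :=
      Definable.all (R := fun i w => i < (w 1).unpair.2 → Nat.beta (w 0) (i + 1) ∈
          g (Nat.pair (w 1).unpair.1 (Nat.pair i (Nat.beta (w 0) i))))
        ((hM.definable_lt (.proj 0) (hM.definableFun_unpair_snd (.proj 2))).imp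
          (hg.comp₂ (r := fun x y => y ∈ g x)
            (hM.definableFun_pair (hM.definableFun_unpair_fst (.proj 2))
              (hM.definableFun_pair (.proj 0) (hM.definableFun_beta (.proj 1) (.proj 0))))
            (hM.definableFun_beta (.proj 1) (DefinableFun.proj 0).succ)))
    have hn : M.Definable fun w : Fin 3 → ℕ => Nat.beta (w 0) (w 1).unpair.2 = w 2 :=
      .eq (hM.definableFun_beta (.proj 0) (hM.definableFun_unpair_snd (.proj 1))) (.proj 2)
    exact (Definable.ex (R := fun c w => Nat.beta c 0 ∈ f (w 0).unpair.1 ∧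
      (∀ i, i < (w 0).unpair.2 → Nat.beta c (i + 1) ∈
        g (Nat.pair (w 0).unpair.1 (Nat.pair i (Nat.beta c i)))) ∧
      Nat.beta c (w 0).unpair.2 = w 1) (h0.and (hs.and hn))).of_iff
      fun w => Nat.mem_rec_iff_exists_beta
        (g := fun y i => g (Nat.pair (w 0).unpair.1 (Nat.pair y i)))
  | @rfind f _ hf =>
    have h0 : M.Definable fun w : Fin 2 → ℕ => 0 ∈ f (Nat.pair (w 0) (w 1)) :=
      hf.comp₂ (r := fun x y => y ∈ f x) (hM.definableFun_pair (.proj 0) (.proj 1)) .zero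
    -- The existence of `k + 1` among the values says at once that `f` is defined and nonzero there.
    have hs : M.Definable fun w : Fin 2 → ℕ =>
        ∀ m, m < w 1 → ∃ k, k + 1 ∈ f (Nat.pair (w 0) m) :=
      Definable.all (R := fun m w => m < w 1 → ∃ k, k + 1 ∈ f (Nat.pair (w 0) m))
        ((hM.definable_lt (.proj 0) (.proj 2)).imp
          (Definable.ex (R := fun k w => k + 1 ∈ f (Nat.pair (w 1) (w 0)))
            (hf.comp₂ (r := fun x y => y ∈ f x) (hM.definableFun_pair (.proj 2) (.proj 1))
              (DefinableFun.proj 0).succ)))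
    refine (h0.and hs).of_iff fun w => ?_
    refine Nat.mem_rfind.trans ?_
    simp only [Part.map_eq_map, Part.mem_map_iff, decide_eq_true_eq,
      decide_eq_false_iff_not, exists_eq_right]
    refine and_congr Iff.rfl (forall_congr' fun m => imp_congr_right fun _ => ⟨?_, ?_⟩)
    · rintro ⟨x, hx, h⟩
      exact ⟨x - 1, by rwa [Nat.sub_add_cancel (Nat.pos_of_ne_zero h)]⟩
    · exact fun ⟨k, hk⟩ => ⟨k + 1, hk, k.succ_ne_zero⟩

/-- A computable function on a coded type is definable with respect to the codes. -/
theorem SatisfiesPA.definable_of_computable (hM : M.SatisfiesPA) {α : Type*} [Primcodable α]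
    {f : α → ℕ} (hf : Computable f) :
    M.Definable fun w : Fin 2 → ℕ => ∃ a : α, Encodable.decode (w 0) = some a ∧ f a = w 1 :=
  -- `hf` unfolds to partial recursiveness of the induced map on codes, undefined at numbers that
  -- decode to nothing.
  (hM.definable_graph hf).of_iff fun w => by simp [eq_comm]

end Interpretation

/-! ### Diagonalisation and the liar -/

/-- The formula `∀ x₀, x₀ = quote A → A`, which says that `A` holds of its own quotation. -/
def Expr.diag (A : Expr .formula) : Expr .formula :=
  .all 0 (.imp (.eq (.var 0) (.quote A)) A)

/-- The operation `Expr.diag` on strings. -/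
def diagStr (s : List Sym) : List Sym :=
  [.all, .var 0, .imp, .eq, .var 0, .quote] ++ (s ++ s)

theorem Expr.str_diag (A : Expr .formula) : A.diag.str = diagStr A.str := by
  simp [Expr.diag, Expr.str, diagStr]

theorem computable_diagStr : Computable diagStr :=
  Computable.list_append.comp (.const _) (Computable.list_append.comp .id .id)

theorem Interpretation.denote_diag (M : Interpretation) (A : Expr .formula) (ρ : ℕ → ℕ) :
    M.denote A.diag ρ ↔ M.denote A (Function.update ρ 0 (M.quote ⟨.formula, A⟩)) := by
  simp [Expr.diag, Interpretation.denote]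

/-- **Tarski's undefinability theorem**: if the quotations denote Gödel numbers, then the predicate
`eval formula` is not a truth predicate. -/
theorem Interpretation.SatisfiesPA.exists_not_eval_iff {M : Interpretation} (hM : M.SatisfiesPA)
    {G : Expression → ℕ} (hG : IsGoedelNumbering G)
    (hquote : ∀ A : Expr .formula, M.quote ⟨.formula, A⟩ = G ⟨.formula, A⟩) (ρ : ℕ → ℕ) :
    ∃ A : Expr .formula, ¬ (M.eval .formula (G ⟨.formula, A⟩) ↔ M.denote A ρ) := by
  obtain ⟨g, hg, hgc, hGg⟩ := hG
  -- The liar predicate. The intermediate `c` is the standard code of a string, so `g` need not be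
  -- inverted: it is only applied to the string and to its diagonal.
  have hdef : M.Definable fun w : Fin 1 → ℕ => ∃ c m,
      ((∃ s : List Sym, Encodable.decode c = some s ∧ g s = w 0) ∧
        ∃ s : List Sym, Encodable.decode c = some s ∧ g (diagStr s) = m) ∧
      ¬ M.eval .formula m :=
    Definable.ex (R := fun c w => ∃ m,
        ((∃ s : List Sym, Encodable.decode c = some s ∧ g s = w 0) ∧
          ∃ s : List Sym, Encodable.decode c = some s ∧ g (diagStr s) = m) ∧
        ¬ M.eval .formula m)
      (Definable.ex (R := fun m w =>
          ((∃ s : List Sym, Encodable.decode (w 0) = some s ∧ g s = w 1) ∧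
            ∃ s : List Sym, Encodable.decode (w 0) = some s ∧ g (diagStr s) = m) ∧
          ¬ M.eval .formula m)
        ((((hM.definable_of_computable hgc).reindex ![1, 2]).and
          ((hM.definable_of_computable (hgc.comp computable_diagStr)).reindex ![1, 0])).and
          (Definable.eval_formula.reindex ![0]).not))
  -- The argument is `x₀`, the variable bound by `Expr.diag`.
  obtain ⟨A, hA⟩ := hdef ![0]
  refine ⟨A.diag, fun h => iff_not_self (a := M.eval .formula (G ⟨.formula, A.diag⟩)) ?_⟩
  rw [M.denote_diag, hA, hquote] at h
  refine h.trans ?_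
  simp only [hGg, Expr.str_diag, Function.comp_apply, Matrix.cons_val_fin_one,
    Function.update_self]
  constructor
  · rintro ⟨c, m, ⟨⟨s, hs, hsA⟩, s', hs', rfl⟩, hm⟩
    obtain rfl := hg hsA
    obtain rfl := Option.some.inj (hs.symm.trans hs')
    exact hm
  · exact fun h => ⟨Encodable.encode A.str, _,
      ⟨⟨_, Encodable.encodek _, rfl⟩, _, Encodable.encodek _, rfl⟩, h⟩

end QuoteEvalArith

/-! ### From the evaluation axiom to a truth predicate -/

open QuoteEvalArith in
theorem mainTheorem6 (G : Expression → ℕ) (hG : IsGoedelNumbering G)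
    (M : Interpretation) (hPA : M.SatisfiesPA) (ρ : ℕ → ℕ)
    (F : SyntaxFramework (M.interpretedLanguage ρ) Set.univ)
    (hF : IsGoedelFramework M ρ G F) :
    ¬ F.EvaluationTotal ∧ ¬ F.EvaluationTotalOnQuotations ∧
      ∃ A : Expr .formula,
        ¬ (F.E (F.Q ⟨(⟨.formula, A⟩ : Expression), Set.mem_univ _⟩)).Dom := by
  have hquote : ∀ e : Expression, M.quote e = G e := fun e => by
    have h := (SyntaxFramework.quotation_axiom F ⟨e, Set.mem_univ _⟩).trans (hF.Vsyn_eq _)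
    rw [← Option.some.inj (hF.builtInQuotation ⟨e, Set.mem_univ _⟩)] at h
    exact Sum.inl.inj h
  have key : ∃ A : Expr .formula,
      ¬ (F.E (F.Q ⟨(⟨.formula, A⟩ : Expression), Set.mem_univ _⟩)).Dom := by
    obtain ⟨A, hA⟩ := hPA.exists_not_eval_iff hG (fun A => hquote ⟨.formula, A⟩) ρ
    refine ⟨A, fun hdom => hA ?_⟩
    obtain ⟨r, hr⟩ := Part.dom_iff_mem.1 hdom
    have hQ := Option.some.inj (hF.builtInQuotation ⟨⟨.formula, A⟩, Set.mem_univ _⟩)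
    obtain ⟨e', he', hV⟩ := SyntaxFramework.evaluation_axiom F _ r hr
    rw [SyntaxFramework.quotation_axiom] at he'
    obtain rfl := F.Vsyn_injective he'
    obtain ⟨i, hi⟩ := hF.builtInEvaluation _ r hr
    rw [← hQ] at hi
    have hi' := Option.some.inj hi
    rw [← hi'] at hV
    -- The type parameter `term` would equate a number with a truth value.
    cases i with
    | term => exact absurd hV Sum.inl_ne_inr
    | formula =>
      have h : M.eval .formula (M.quote ⟨.formula, A⟩) = M.denote A ρ := Sum.inr.inj hV
      rw [← hquote, h]
  obtain ⟨A, hA⟩ := key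
  exact ⟨fun h => hA (h _), fun h => hA (h _), A, hA⟩
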